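/- **Corollary 4.1.** Let $\mathcal Z,\mathcal Y$ be finite-dimensional real Hilbert spaces, let $h:\mathcal Z\to\mathbb R$ be convex and differentiable with $\|\nabla h(u)-\nabla h(v)\|\le L\|u-v\|$ for all $u,v$, where $L>0$, let $P:\mathcal Y\to(-\infty,\infty]$ be proper, closed and convex, let $\mathcal M:\mathcal Z\to\mathcal Y$ be a nonzero linear map with adjoint $\mathcal M^*$, and let $b\in\mathcal Y$. Assume that the problem $$\min_z\; h(z)+P(\mathcal M z-b) \tag{P}$$ has an optimal solution and that $(\mathrm{Range}(\mathcal M)-b)\cap \mathrm{ri}(\mathrm{dom}\,P)\ne\emptyset$. Write $f^*$ for the convex conjugate of $f$, let $$D(x,y):=h^*(x)+P^*(y)+\langle b,y\rangle ,$$ and consider the dual problem $$\min_{x,y}\; D(x,y)\quad\text{s.t.}\quad x+\mathcal M^*y=0. \tag{D}$$ Set $\beta=1/L$, $\tau=\beta\|\mathcal M^*\mathcal M\|$, $\mathcal T=\tau\mathcal I-\beta\mathcal M\mathcal M^*$ and $\|y\|_{\mathcal T}=\sqrt{\langle y,\mathcal T y\rangle}$. Let $(y^0,z^0)\in\mathcal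 Y\times\mathcal Z$ be arbitrary and let $\{(y^t,z^t)\}$ be generated by the proximal-proximal gradient (PPG) algorithm with $\gamma=1$: for $t\ge 0$, $$y^{t+1}=\mathrm{prox}_{\tau^{-1}P^*}\!\left(\tfrac1\tau\big(\mathcal T y^t-b+\mathcal M z^t-\beta\mathcal M\nabla h(z^t)\big)\right),\qquad z^{t+1}=z^t-\beta\big(\nabla h(z^t)+\mathcal M^*y^{t+1}\big),$$ where $\mathrm{prox}_f(w)=\arg\min_u\{f(u)+\tfrac12\|u-w\|^2\}$. Put $x^{t+1}=\nabla h(z^t)$ for $t\ge0$ and $(\bar x^N,\bar y^N)=\frac1N\sum_{t=1}^N(x^t,y^t)$ for $N\ge1$. Then $\{(x^t,y^t,z^t)\}$ converges to some $(\bar x,\bar y,\bar z)$ such that $(\bar x,\bar y)$ is an optimal solution of (D), with $D(\bar x,\bar y)$ finite, and $\bar z$ is an optimal solution of (P); and, for every $N\ge1$, $$-2\|\bar z\|\sqrt{\tfrac LN}\,\sqrt{L\|z^0-\bar z\|^2+\|y^0-\bar y\|_{\mathcal T}^2}\;\le\; D(\bar x^N,\bar y^N)-D(\bar x,\bar y)$$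 $$\le\;\frac1{2N}\Big(L\|z^0\|^2+\|y^0-\bar y\|_{\mathcal T}^2\Big)+\frac1N\Big(L\|z^0-\bar z\|^2+\|y^0-\bar y\|_{\mathcal T}^2\Big),$$ and $$\|\bar x^N+\mathcal M^*\bar y^N\|\;\le\;2\sqrt{\tfrac LN}\,\sqrt{L\|z^0-\bar z\|^2+\|y^0-\bar y\|_{\mathcal T}^2}.$$ -/

import Mathlib

open Set Filter Topology

namespace PPG

noncomputable section

/-- Proper closed convex functions `f : E → (-∞, ∞]`: the value `-∞` is never taken, the domain is
nonempty, `f` is lower semicontinuous, and the epigraph of `f` is convex. -/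
structure IsProperClosedConvex {E : Type*} [NormedAddCommGroup E] [InnerProductSpace ℝ E]
    (f : E → EReal) : Prop where
  ne_bot : ∀ u, f u ≠ ⊥
  exists_ne_top : ∃ u, f u ≠ ⊤
  lsc : LowerSemicontinuous f
  convex_epi : Convex ℝ {p : E × ℝ | f p.1 ≤ (p.2 : EReal)}

/-- The effective domain `{u | f u < ∞}`. -/
def effDom {E : Type*} (f : E → EReal) : Set E := {u | f u < ⊤}

/-- The convex conjugate `f^*(v) = sup_u (⟨v, u⟩ - f u)`. -/
def conj {E : Type*} [NormedAddCommGroup E] [InnerProductSpace ℝ E]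
    (f : E → EReal) (v : E) : EReal :=
  ⨆ u : E, ((inner ℝ v u : ℝ) : EReal) - f u

/-- `p = prox_f(w)`: the point `p` minimizes `u ↦ f u + ‖u - w‖² / 2`.  (For a proper closed convex
`f` the minimizer exists and is unique.) -/
def IsProx {E : Type*} [NormedAddCommGroup E] [InnerProductSpace ℝ E]
    (f : E → EReal) (w p : E) : Prop :=
  ∀ u : E, f p + ((‖p - w‖ ^ 2 / 2 : ℝ) : EReal) ≤ f u + ((‖u - w‖ ^ 2 / 2 : ℝ) : EReal)

/-- The (semi)norm `‖y‖_T = √⟨y, T y⟩` induced by a positive semidefinite `T`. -/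
def seminormOf {E : Type*} [NormedAddCommGroup E] [InnerProductSpace ℝ E]
    (T : E →L[ℝ] E) (y : E) : ℝ :=
  √(inner ℝ y (T y))

variable {Z Y : Type*}
  [NormedAddCommGroup Z] [InnerProductSpace ℝ Z] [CompleteSpace Z]
  [NormedAddCommGroup Y] [InnerProductSpace ℝ Y] [CompleteSpace Y]

/-- The primal objective `F(z) = h(z) + P(M z - b)`. -/
def primalObj (h : Z → ℝ) (P : Y → EReal) (M : Z →L[ℝ] Y) (b : Y) (z : Z) : EReal :=
  (h z : EReal) + P (M z - b)

/-- The objective `h^*(x) + P^*(y) + ⟨b, y⟩` of the dual problem, whose constraint is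
`x + M^* y = 0`. -/
def dualObj (h : Z → ℝ) (P : Y → EReal) (b : Y) (x : Z) (y : Y) : EReal :=
  conj (fun z => (h z : EReal)) x + conj P y + ((inner ℝ b y : ℝ) : EReal)

/-- The proximal operator weight `T = τ I - β M M^*`. -/
def proxWeight (M : Z →L[ℝ] Y) (β τ : ℝ) : Y →L[ℝ] Y :=
  τ • ContinuousLinearMap.id ℝ Y - β • (M ∘L M.adjoint)

/-- `(y^t, z^t)` is generated by the proximal-proximal gradient algorithm with parameters
`β, τ, γ` from the initial point `(y^0, z^0)`:
`y^{t+1} = prox_{τ⁻¹ P^*} ((T y^t - b + M z^t - β M ∇h(z^t)) / τ)` and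
`z^{t+1} = z^t - γ β (∇h(z^t) + M^* y^{t+1})`. -/
structure IsPPG (h : Z → ℝ) (P : Y → EReal) (M : Z →L[ℝ] Y) (b : Y) (β τ γ : ℝ)
    (y : ℕ → Y) (z : ℕ → Z) : Prop where
  y_step : ∀ t : ℕ,
    IsProx (fun u => ((τ⁻¹ : ℝ) : EReal) * conj P u)
      (τ⁻¹ • (proxWeight M β τ (y t) - b + M (z t) - β • M (gradient h (z t))))
      (y (t + 1))
  z_step : ∀ t : ℕ,
    z (t + 1) = z t - (γ * β) • (gradient h (z t) + M.adjoint (y (t + 1)))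

/-- The ergodic average `(1 / N) ∑_{t = 1}^N w^t`. -/
def ergodicAvg {E : Type*} [AddCommGroup E] [Module ℝ E] (w : ℕ → E) (N : ℕ) : E :=
  (1 / (N : ℝ)) • ∑ t ∈ Finset.Icc 1 N, w t

end

end PPG

/-! The argument rests on the optimality system `IsSaddle`: `∇h(z) + M^* y = 0` and `M z - b ∈
∂P^*(y)`. The qualification and a primal minimizer give a solution (`exists_multiplier`,
`exists_isSaddle`), and every solution solves both problems.

The prox step says exactly that `M z^{t+1} - b + T (y^t - y^{t+1}) ∈ ∂P^*(y^{t+1})`, while `x^{t+1}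
= ∇h(z^t)` gives `z^t ∈ ∂h^*(x^{t+1})`, with `z^t` in place of `z^{t+1}`. The `1/L`-strong convexity
of `h^*` pays for this delay exactly when `β = 1/L`. The outcome is `IsIteration.gap_le`: for any
`w`, twice the dual gap minus `⟨w, residual⟩` is at most the drop of `L ‖z - w‖² + ‖y - y'‖_T²`.

With `w = z'` at a saddle point the gap is nonnegative, so the energy decreases and the residuals
vanish. A cluster point is again a saddle, and the energy measured from it tends to `0`, which
yields convergence. With `w = 0`, summation and Jensen's inequality bound the ergodic dual value
from above. The residual telescopes to `(L/N) (z^0 - z^N)`, and the saddle inequality turns its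
bound into the lower bound. -/

namespace PPG

/-! ### Convex functions with Lipschitz gradient -/

section Smooth

/-- A one-sided linear upper bound on a function bounds its derivative. -/
lemma deriv_le_of_le_add_mul {φ : ℝ → ℝ} {φ' C : ℝ} (hφ : HasDerivAt φ φ' 0)
    (hle : ∀ s : ℝ, 0 < s → s ≤ 1 → φ s ≤ φ 0 + s * C) : φ' ≤ C := by
  have ht := hφ.tendsto_slope_zero_right
  refine le_of_tendsto ht ?_
  have h1 : Ioc (0 : ℝ) 1 ∈ 𝓝[>] (0 : ℝ) := Ioc_mem_nhdsGT one_pos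
  filter_upwards [h1] with s hs
  have := hle s hs.1 hs.2
  simp only [zero_add, smul_eq_mul]
  rw [inv_mul_le_iff₀ hs.1]
  linarith

variable {Z : Type*} [NormedAddCommGroup Z] [InnerProductSpace ℝ Z] [CompleteSpace Z]
  {h : Z → ℝ}

lemma hasDerivAt_line (hdiff : Differentiable ℝ h) (z d : Z) (s : ℝ) :
    HasDerivAt (fun s : ℝ => h (z + s • d)) (inner ℝ (gradient h (z + s • d)) d) s := by
  have h1 : HasDerivAt (fun s : ℝ => z + s • d) d s := by
    simpa using ((hasDerivAt_id s).smul_const d).const_add z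
  have h2 := (hdiff (z + s • d)).hasFDerivAt.comp_hasDerivAt s h1
  rwa [← inner_gradient_left] at h2

lemma gradient_ineq (hconv : ConvexOn ℝ univ h) (hdiff : Differentiable ℝ h) (z u : Z) :
    h z + inner ℝ (gradient h z) (u - z) ≤ h u := by
  have h0 := hasDerivAt_line hdiff z (u - z) 0
  simp only [zero_smul, add_zero] at h0
  have := deriv_le_of_le_add_mul (C := h u - h z) h0 (fun s hs hs1 => by
    have := hconv.2 (mem_univ z) (mem_univ u) (sub_nonneg.2 hs1) hs.le (by ring)
    have e : (1 - s) • z + s • u = z + s • (u - z) := by module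
    rw [e] at this
    simp only [smul_eq_mul] at this
    simp only [zero_smul, add_zero]
    linarith)
  linarith

/-- The descent lemma. -/
lemma descent_lemma {L : ℝ} (hdiff : Differentiable ℝ h)
    (hLip : ∀ u v : Z, ‖gradient h u - gradient h v‖ ≤ L * ‖u - v‖) (z u : Z) :
    h u ≤ h z + inner ℝ (gradient h z) (u - z) + L / 2 * ‖u - z‖ ^ 2 := by
  set d := u - z with hd
  have hder : ∀ s : ℝ, HasDerivAt
      (fun s : ℝ => h (z + s • d) - s * inner ℝ (gradient h z) d - L / 2 * ‖d‖ ^ 2 * s ^ 2)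
      (inner ℝ (gradient h (z + s • d)) d - inner ℝ (gradient h z) d
        - L / 2 * ‖d‖ ^ 2 * (2 * s)) s := by
    intro s
    have h1 := (hasDerivAt_id s).mul_const (inner ℝ (gradient h z) d)
    have h2 := (hasDerivAt_pow 2 s).const_mul (L / 2 * ‖d‖ ^ 2)
    exact (((hasDerivAt_line hdiff z d s).sub h1).sub h2).congr_deriv (by simp)
  have hanti := antitoneOn_of_deriv_nonpos (convex_Icc (0 : ℝ) 1)
    (fun s _ => (hder s).continuousAt.continuousWithinAt)
    (fun s _ => (hder s).differentiableAt.differentiableWithinAt)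
    (fun s hs => by
      rw [(hder s).deriv]
      rw [interior_Icc] at hs
      have h1 := real_inner_le_norm (gradient h (z + s • d) - gradient h z) d
      have h2 := hLip (z + s • d) z
      rw [add_sub_cancel_left, norm_smul, Real.norm_of_nonneg hs.1.le] at h2
      have h3 := mul_le_mul_of_nonneg_right h2 (norm_nonneg d)
      rw [inner_sub_left] at h1
      nlinarith)
  have := hanti (left_mem_Icc.2 zero_le_one) (right_mem_Icc.2 zero_le_one) zero_le_one
  have e : z + d = u := by rw [hd]; abel
  simp only [one_smul, zero_smul, add_zero, e] at this
  linarith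

end Smooth

/-! ### Convex conjugates, the prox step and Fenchel equality -/

section Conj

variable {E : Type*} [NormedAddCommGroup E] [InnerProductSpace ℝ E]

/-- Reduces extended-real bounds on a conjugate to affine minorants of `f`. Convexity, Jensen and
closedness of `f^*` then become statements about families of affine inequalities. -/
lemma conj_le_coe_iff {f : E → EReal} {v : E} {c : ℝ} :
    conj f v ≤ (c : EReal) ↔ ∀ u, ((inner ℝ v u - c : ℝ) : EReal) ≤ f u := by
  unfold conj
  rw [iSup_le_iff]
  refine forall_congr' fun u => ?_
  induction f u with
  | bot => simp [-EReal.coe_sub]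
  | top => simp
  | coe a =>
    norm_cast
    constructor <;> intro h <;> linarith

lemma conj_ne_bot {f : E → EReal} (hf : ∃ u, f u ≠ ⊤) (v : E) : conj f v ≠ ⊥ := by
  obtain ⟨u, hu⟩ := hf
  intro hv
  have := le_iSup (fun u : E => ((inner ℝ v u : ℝ) : EReal) - f u) u
  change _ ≤ conj f v at this
  rw [hv, le_bot_iff] at this
  induction hfu : f u with
  | bot => rw [hfu] at this; simp at this
  | top => exact hu hfu
  | coe a => rw [hfu] at this; norm_cast at this

lemma conj_combo_le {f : E → EReal} {v w : E} {a c s : ℝ} (hv : conj f v ≤ (a : EReal))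
    (hw : conj f w ≤ (c : EReal)) (hs : 0 ≤ s) (hs1 : s ≤ 1) :
    conj f (v + s • (w - v)) ≤ (((1 - s) * a + s * c : ℝ) : EReal) := by
  rw [conj_le_coe_iff] at *
  intro u
  have h1 := hv u
  have h2 := hw u
  induction hfu : f u with
  | bot => exact absurd (le_bot_iff.1 (hfu ▸ h1)) (EReal.coe_ne_bot _)
  | top => simp
  | coe r =>
    rw [hfu] at h1 h2
    norm_cast at *
    rw [inner_add_left, inner_smul_left, inner_sub_left]
    simp only [conj_trivial]
    nlinarith [mul_le_mul_of_nonneg_left h1 (sub_nonneg.2 hs1), mul_le_mul_of_nonneg_left h2 hs]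

lemma conj_avg_le {f : E → EReal} (v : ℕ → E) (c : ℕ → ℝ) {N : ℕ} (hN : 1 ≤ N)
    (hv : ∀ t ∈ Finset.Icc 1 N, conj f (v t) ≤ (c t : EReal)) :
    conj f (ergodicAvg v N) ≤ ((1 / (N : ℝ) * ∑ t ∈ Finset.Icc 1 N, c t : ℝ) : EReal) := by
  rw [conj_le_coe_iff]
  intro u
  have h1 := fun t ht => conj_le_coe_iff.1 (hv t ht) u
  induction hfu : f u with
  | bot =>
    have := h1 1 (Finset.mem_Icc.2 ⟨le_rfl, hN⟩)
    exact absurd (le_bot_iff.1 (hfu ▸ this)) (EReal.coe_ne_bot _)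
  | top => simp
  | coe r =>
    simp only [hfu, EReal.coe_le_coe_iff] at h1 ⊢
    have hN0 : (0 : ℝ) < N := by exact_mod_cast hN
    have h2 := Finset.sum_le_sum h1
    rw [ergodicAvg, inner_smul_left, sum_inner]
    simp only [Finset.sum_sub_distrib, Finset.sum_const, Nat.card_Icc, Nat.add_sub_cancel,
      nsmul_eq_mul] at h2
    simp only [conj_trivial]
    rw [← mul_sub, one_div, inv_mul_le_iff₀ hN0]
    exact h2

/-- The epigraph of a supremum of continuous affine functions is closed. This allows limits along
the iterates although `P^*` need not be continuous. -/
lemma conj_le_of_tendsto {f : E → EReal} {v : ℕ → E} {c : ℕ → ℝ} {w : E} {a : ℝ}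
    (hv : Tendsto v atTop (𝓝 w)) (hc : Tendsto c atTop (𝓝 a))
    (h : ∀ n, conj f (v n) ≤ (c n : EReal)) : conj f w ≤ (a : EReal) := by
  rw [conj_le_coe_iff]
  intro u
  refine le_of_tendsto' (f := fun n => ((inner ℝ (v n) u - c n : ℝ) : EReal)) (x := atTop) ?_
    (fun n => conj_le_coe_iff.1 (h n) u)
  exact (continuous_coe_real_ereal.tendsto _).comp ((hv.inner tendsto_const_nhds).sub hc)

/-- The optimality condition of the proximal step. -/
lemma IsProx.subgradient {f : E → EReal} {τ : ℝ} (hτ : 0 < τ) {w p : E}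
    (hp : IsProx (fun u => ((τ⁻¹ : ℝ) : EReal) * conj f u) w p) {a : ℝ} (ha : conj f p = a)
    {u : E} {c : ℝ} (hc : conj f u ≤ (c : EReal)) (hbot : ∀ v, conj f v ≠ ⊥) :
    a + inner ℝ (τ • (w - p)) (u - p) ≤ c := by
  -- Compare `p` with points of the segment towards `u`, using convexity of `f^*`; letting `s → 0`
  -- leaves the first-order condition.
  have key : ∀ s : ℝ, 0 < s → s ≤ 1 →
      τ⁻¹ * a + ‖p - w‖ ^ 2 / 2 ≤
        τ⁻¹ * ((1 - s) * a + s * c) + ‖(p - w) + s • (u - p)‖ ^ 2 / 2 := by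
    intro s hs hs1
    have h1 := hp (p + s • (u - p))
    have h2 := conj_combo_le ha.le hc hs.le hs1
    simp only [ha] at h1
    have e : p + s • (u - p) - w = p - w + s • (u - p) := by abel
    rw [e] at h1
    induction hr : conj f (p + s • (u - p)) with
    | bot => exact absurd hr (hbot _)
    | top => exact absurd (top_le_iff.1 (hr ▸ h2)) (EReal.coe_ne_top _)
    | coe r =>
      rw [hr] at h1 h2
      norm_cast at h1 h2
      have := mul_le_mul_of_nonneg_left h2 (inv_pos.2 hτ).le
      linarith
  have hd : HasDerivAt (fun s : ℝ => -(‖(p - w) + s • (u - p)‖ ^ 2 / 2))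
      (-(inner ℝ (p - w) (u - p))) 0 := by
    have h1 : HasDerivAt (fun s : ℝ => (p - w) + s • (u - p)) (u - p) 0 := by
      simpa using ((hasDerivAt_id (0 : ℝ)).smul_const (u - p)).const_add (p - w)
    have h2 := (h1.norm_sq.div_const 2).neg
    exact h2.congr_deriv (by simp)
  have := deriv_le_of_le_add_mul (C := τ⁻¹ * (c - a)) hd (fun s hs hs1 => by
    have := key s hs hs1
    simp only [zero_smul, add_zero]
    linarith)
  have h3 := mul_le_mul_of_nonneg_left this hτ.le
  rw [mul_inv_cancel_left₀ hτ.ne'] at h3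
  have e : inner ℝ (τ • (w - p)) (u - p) = τ * -(inner ℝ (p - w) (u - p)) := by
    rw [inner_smul_left, ← neg_sub p w, inner_neg_left]; simp
  rw [e]
  linarith

/-- At a subgradient `v` of `f^*` at `y`, the Fenchel equality holds. -/
lemma IsProperClosedConvex.le_of_subgradient_conj [CompleteSpace E] {f : E → EReal}
    (hf : IsProperClosedConvex f) {y v : E} {p : ℝ} (hp : conj f y = p)
    (hsub : ∀ (w : E) (c : ℝ), conj f w ≤ (c : EReal) → p + inner ℝ v (w - y) ≤ c) :
    f v ≤ ((inner ℝ y v - p : ℝ) : EReal) := by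
  by_contra hlt
  have hclosed : IsClosed {q : E × ℝ | f q.1 ≤ (q.2 : EReal)} := by
    have := hf.lsc.isClosed_epigraph
    exact this.preimage (f := fun q : E × ℝ => (q.1, (q.2 : EReal)))
      (continuous_fst.prodMk (continuous_coe_real_ereal.comp continuous_snd))
  have hnot : (v, inner ℝ y v - p) ∉ {q : E × ℝ | f q.1 ≤ (q.2 : EReal)} := hlt
  -- If the claim fails, a hyperplane with normal `(a, α)` strictly separates `(v, ⟨y, v⟩ - p)` from
  -- the epigraph.
  obtain ⟨g, γ, hg1, hg2⟩ := geometric_hahn_banach_closed_point hf.convex_epi hclosed hnot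
  set a : E := (InnerProductSpace.toDual ℝ E).symm (g.comp (ContinuousLinearMap.inl ℝ E ℝ))
    with ha
  set α : ℝ := g (0, 1) with hα
  have hgv : ∀ (u : E) (r : ℝ), g (u, r) = inner ℝ a u + r * α := by
    intro u r
    have e : (u, r) = (u, (0 : ℝ)) + r • ((0 : E), (1 : ℝ)) := by simp
    rw [e, map_add, map_smul, ha, InnerProductSpace.toDual_symm_apply]
    simp [hα]
  simp only [hgv, mem_ofPred_eq, Prod.forall] at hg1 hg2
  obtain ⟨u0, hu0⟩ := hf.exists_ne_top
  obtain ⟨r0, hr0⟩ : ∃ r : ℝ, f u0 = r :=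
    ⟨(f u0).toReal, (EReal.coe_toReal hu0 (hf.ne_bot u0)).symm⟩
  have hα0 : α ≤ 0 := by
    by_contra! hpos
    set k := max r0 ((γ - inner ℝ a u0) / α) with hk
    have h1 := hg1 u0 k (by rw [hr0]; exact_mod_cast le_max_left _ _)
    have h2 : (γ - inner ℝ a u0) / α ≤ k := le_max_right _ _
    rw [div_le_iff₀ hpos] at h2
    linarith
  -- A non-vertical hyperplane, rescaled, bounds `f^*` at `a / (-α)`. A vertical one bounds `⟨a, ·⟩`
  -- by `γ` on the domain, hence `f^*(y + a) ≤ p + γ`. Either bound contradicts the subgradient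
  -- inequality.
  rcases hα0.lt_or_eq with hneg | hzero
  · have hn : 0 < -α := by linarith
    have h1 : conj f ((-α)⁻¹ • a) ≤ (((-α)⁻¹ * γ : ℝ) : EReal) := by
      rw [conj_le_coe_iff]
      intro u
      induction hfu : f u with
      | bot => exact absurd hfu (hf.ne_bot u)
      | top => simp
      | coe r =>
        have := hg1 u r hfu.le
        norm_cast
        rw [inner_smul_left, conj_trivial, ← mul_sub, inv_mul_le_iff₀ hn]
        linarith
    have h2 := hsub _ _ h1
    rw [inner_sub_right, inner_smul_right, real_inner_comm a v, real_inner_comm y v] at h2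
    have h3 := mul_le_mul_of_nonneg_left h2 hn.le
    rw [mul_inv_cancel_left₀ hn.ne', mul_add, mul_sub, mul_inv_cancel_left₀ hn.ne'] at h3
    linarith
  · have h1 : conj f (y + a) ≤ ((p + γ : ℝ) : EReal) := by
      rw [conj_le_coe_iff]
      intro u
      have hu := conj_le_coe_iff.1 hp.le u
      induction hfu : f u with
      | bot => exact absurd hfu (hf.ne_bot u)
      | top => simp
      | coe r =>
        have := hg1 u r hfu.le
        rw [hfu] at hu
        norm_cast at hu ⊢
        rw [inner_add_left]
        rw [hzero] at this
        linarith
    have h2 := hsub _ _ h1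
    rw [add_sub_cancel_left, real_inner_comm] at h2
    rw [hzero] at hg2
    linarith

end Conj

/-! ### Conjugates of smooth functions -/

section SmoothConj

variable {Z : Type*} [NormedAddCommGroup Z] [InnerProductSpace ℝ Z] [CompleteSpace Z]
  {h : Z → ℝ}

lemma conj_gradient (hconv : ConvexOn ℝ univ h) (hdiff : Differentiable ℝ h) (z : Z) :
    conj (fun z => (h z : EReal)) (gradient h z)
      = ((inner ℝ (gradient h z) z - h z : ℝ) : EReal) := by
  refine le_antisymm (conj_le_coe_iff.2 fun u => ?_) ?_
  · have := gradient_ineq hconv hdiff z u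
    rw [inner_sub_right] at this
    exact_mod_cast (by linarith)
  · have := le_iSup (fun u : Z => ((inner ℝ (gradient h z) u : ℝ) : EReal) - (h u : EReal)) z
    exact_mod_cast this

/-- The conjugate of an `L`-smooth function is `1 / L`-strongly convex. -/
lemma conj_ge_of_lipschitz {L : ℝ} (hL : 0 < L) (hdiff : Differentiable ℝ h)
    (hLip : ∀ u v : Z, ‖gradient h u - gradient h v‖ ≤ L * ‖u - v‖) (z x : Z) {c : ℝ}
    (hc : conj (fun z => (h z : EReal)) x ≤ (c : EReal)) :
    inner ℝ (gradient h z) z - h z + inner ℝ z (x - gradient h z)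
      + 1 / (2 * L) * ‖x - gradient h z‖ ^ 2 ≤ c := by
  set d := x - gradient h z with hd
  -- This test point maximizes `⟨x, ·⟩` minus the quadratic upper model of `h` at `z`.
  have h1 := conj_le_coe_iff.1 hc (z + L⁻¹ • d)
  have h2 := descent_lemma hdiff hLip z (z + L⁻¹ • d)
  norm_cast at h1
  have hx : x = gradient h z + d := by rw [hd]; abel
  rw [add_sub_cancel_left, norm_smul, inner_smul_right, mul_pow, Real.norm_of_nonneg
    (inv_pos.2 hL).le] at h2
  rw [hx, inner_add_right, inner_smul_right, inner_add_left, inner_add_left,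
    real_inner_self_eq_norm_sq, real_inner_comm z d] at h1
  have e : L / 2 * (L⁻¹ ^ 2 * ‖d‖ ^ 2) = 1 / (2 * L) * ‖d‖ ^ 2 := by field_simp
  have e2 : L⁻¹ * ‖d‖ ^ 2 = 2 * (1 / (2 * L) * ‖d‖ ^ 2) := by field_simp
  rw [e] at h2
  linarith

end SmoothConj

end PPG

namespace PPG

/-! ### Lagrange multipliers under the relative interior condition -/

section Multiplier

/-- Moving a little from a relative interior point in a direction of the affine span stays inside
the set. -/
lemma exists_pos_add_smul_mem {E : Type*} [NormedAddCommGroup E] [NormedSpace ℝ E] {s : Set E}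
    {x d : E} (hx : x ∈ intrinsicInterior ℝ s) (hd : d ∈ vectorSpan ℝ s) :
    ∃ ε : ℝ, 0 < ε ∧ x + ε • d ∈ s := by
  obtain ⟨x', hx', rfl⟩ := mem_intrinsicInterior.1 hx
  have hmem : ∀ t : ℝ, (x' : E) + t • d ∈ affineSpan ℝ s := fun t => by
    rw [add_comm]
    refine AffineSubspace.vadd_mem_of_mem_direction ?_ x'.2
    rw [direction_affineSpan]
    exact Submodule.smul_mem _ _ hd
  let φ : ℝ → affineSpan ℝ s := fun t => ⟨(x' : E) + t • d, hmem t⟩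
  have hφ : Continuous φ := Continuous.subtype_mk (by fun_prop) _
  have h0 : φ 0 = x' := by ext; simp [φ]
  have hev : ∀ᶠ t in 𝓝 (0 : ℝ), φ t ∈ ((↑) ⁻¹' s : Set (affineSpan ℝ s)) := by
    refine hφ.continuousAt.eventually_mem ?_
    rw [h0]
    exact mem_interior_iff_mem_nhds.1 hx'
  obtain ⟨ε, hε⟩ := ((hev.filter_mono nhdsWithin_le_nhds).and
    (self_mem_nhdsWithin (s := Ioi (0 : ℝ)))).exists
  exact ⟨ε, hε.2, hε.1⟩

variable {Z Y : Type*}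
  [NormedAddCommGroup Z] [InnerProductSpace ℝ Z] [CompleteSpace Z]
  [NormedAddCommGroup Y] [InnerProductSpace ℝ Y] [FiniteDimensional ℝ Y] [CompleteSpace Y]

/-- A minimizer of `z ↦ P (v₀ + M z) + ⟨g, z⟩` at `z = 0` admits a Lagrange multiplier, under the
relative interior qualification. -/
lemma exists_multiplier {P : Y → EReal} (hP : IsProperClosedConvex P) (M : Z →L[ℝ] Y) {v₀ : Y}
    {c : ℝ} (hv₀ : P v₀ = c) (g : Z)
    (hopt : ∀ (z : Z) (a : ℝ), P (v₀ + M z) ≤ (a : EReal) → c ≤ a + inner ℝ g z)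
    (hri : ∃ w, v₀ + M w ∈ intrinsicInterior ℝ (effDom P)) :
    ∃ y : Y, g + M.adjoint y = 0 ∧ ∀ v, ((c + inner ℝ y (v - v₀) : ℝ) : EReal) ≤ P v := by
  obtain ⟨w, hw⟩ := hri
  set S := vectorSpan ℝ (effDom P) with hS
  have hv₀dom : v₀ ∈ effDom P := by simp [effDom, hv₀]
  have hmemS : ∀ v, P v < ⊤ → v - v₀ ∈ S := fun v hv => vsub_mem_vectorSpan ℝ hv hv₀dom
  -- Perturbations outside `S + range M` never reach the domain of `P`; a complement `U` carries
  -- those directions, on which the functional is set to zero.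
  obtain ⟨U, hU⟩ := Submodule.exists_isCompl (S ⊔ LinearMap.range (M : Z →ₗ[ℝ] Y))
  -- Epigraph of the perturbed objective `(z, u) ↦ P (v₀ + M z + u) + ⟨g, z⟩ - c`.
  let C : Set (Z × Y × ℝ) :=
    {q | P (v₀ + M q.1 + q.2.1) ≤ ((q.2.2 + c - inner ℝ g q.1 : ℝ) : EReal)}
  have hC : Convex ℝ C := by
    intro q hq q' hq' s t hs ht hst
    have := hP.convex_epi (x := (v₀ + M q.1 + q.2.1, q.2.2 + c - inner ℝ g q.1)) hq
      (y := (v₀ + M q'.1 + q'.2.1, q'.2.2 + c - inner ℝ g q'.1)) hq' hs ht hst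
    obtain rfl : t = 1 - s := by linarith
    change P _ ≤ _ at this
    change P _ ≤ _
    convert this using 2
    · simp
      module
    · simp [inner_add_right, inner_smul_right]
      norm_cast
      ring
  have h0 : (0 : Z × Y × ℝ) ∈ C := by simp [C, hv₀]
  let K : PointedCone ℝ (Z × Y × ℝ) :=
    (ConvexCone.hull ℝ C).toPointedCone (ConvexCone.subset_hull h0)
  have hK : ∀ q, q ∈ K ↔ ∃ k : ℝ, 0 < k ∧ ∃ q' ∈ C, k • q' = q := fun q =>
    ConvexCone.mem_hull_of_convex hC
  let F : (Z × Y × ℝ) →ₗ.[ℝ] ℝ :=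
    { domain := U.comap (LinearMap.fst ℝ Y ℝ ∘ₗ LinearMap.snd ℝ Z (Y × ℝ))
      toFun := (LinearMap.snd ℝ Y ℝ ∘ₗ LinearMap.snd ℝ Z (Y × ℝ)) ∘ₗ Submodule.subtype _ }
  -- `(z, u, r) ↦ r`, given for `u ∈ U`, is extended to a functional nonnegative on the cone over
  -- `C`. Optimality of `v₀` gives positivity, since a point of `C` with `u ∈ U` has `u = 0`; the
  -- relative interior point gives the translates into the cone.
  obtain ⟨G, hGF, hGK⟩ := riesz_extension K F (by
    rintro ⟨q, hq⟩ hqK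
    obtain ⟨k, hk, q', hq', rfl⟩ := (hK _).1 hqK
    change 0 ≤ k * q'.2.2
    have hu : q'.2.1 ∈ U := by
      have : k • q'.2.1 ∈ U := hq
      exact (U.smul_mem_iff hk.ne').1 this
    have hs := hmemS _ (lt_of_le_of_lt hq' (EReal.coe_lt_top _))
    have hmem : q'.2.1 ∈ S ⊔ LinearMap.range (M : Z →ₗ[ℝ] Y) := by
      have e : q'.2.1 = (v₀ + M q'.1 + q'.2.1 - v₀) + M (-q'.1) := by rw [map_neg]; abel
      rw [e]
      exact Submodule.add_mem_sup hs ⟨-q'.1, rfl⟩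
    have hz : q'.2.1 = 0 := (Submodule.disjoint_def.1 hU.disjoint) _ hmem hu
    have := hopt q'.1 (q'.2.2 + c - inner ℝ g q'.1) (by simpa [C, hz] using hq')
    refine mul_nonneg hk.le ?_
    linarith) (by
    rintro ⟨z, y, r⟩
    have hy : y ∈ (S ⊔ LinearMap.range (M : Z →ₗ[ℝ] Y)) ⊔ U := by
      rw [hU.codisjoint.eq_top]; trivial
    obtain ⟨y₁, hy₁, u, hu, rfl⟩ := Submodule.mem_sup.1 hy
    obtain ⟨s, hs, _, ⟨m, rfl⟩, rfl⟩ := Submodule.mem_sup.1 hy₁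
    obtain ⟨ε, hε, hmem⟩ := exists_pos_add_smul_mem hw hs
    obtain ⟨a, ha⟩ : ∃ a : ℝ, P (v₀ + M w + ε • s) = a :=
      ⟨_, (EReal.coe_toReal hmem.ne (hP.ne_bot _)).symm⟩
    -- Chosen so that the sum with the given vector is `ε⁻¹` times a point of `C` at which `P` is
    -- evaluated at `v₀ + M w + ε • s`.
    refine ⟨⟨(ε⁻¹ • w - m - z, -u, ε⁻¹ * (a - c + inner ℝ g (w - ε • m)) - r), U.neg_mem hu⟩,
      (hK _).2 ⟨ε⁻¹, inv_pos.2 hε,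
      (w - ε • m, ε • (s + M m), a - c + inner ℝ g (w - ε • m)), ?_, ?_⟩⟩
    · change P _ ≤ _
      have e : v₀ + M (w - ε • m) + ε • (s + M m) = v₀ + M w + ε • s := by
        rw [map_sub, map_smul]; module
      rw [e, ha, EReal.coe_le_coe_iff]
      exact le_of_eq (by ring)
    · refine Prod.ext ?_ (Prod.ext ?_ ?_)
      · simp [smul_sub, hε.ne']
      · simp [hε.ne']
      · simp)
  have hGr : ∀ r : ℝ, G (0, 0, r) = r := fun r => hGF ⟨(0, 0, r), U.zero_mem⟩
  have hGz : ∀ z : Z, G (z, 0, 0) = 0 := fun z => hGF ⟨(z, 0, 0), U.zero_mem⟩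
  let ψ : Y →ₗ[ℝ] ℝ := -(G ∘ₗ LinearMap.inr ℝ Z (Y × ℝ) ∘ₗ LinearMap.inl ℝ Y ℝ)
  set y : Y := (InnerProductSpace.toDual ℝ Y).symm (LinearMap.toContinuousLinearMap ψ) with hy
  have hψ : ∀ v, inner ℝ y v = -G (0, v, 0) := fun v => by
    rw [hy, InnerProductSpace.toDual_symm_apply]; rfl
  have hGC : ∀ (z : Z) (v : Y) (r : ℝ), (z, v, r) ∈ C → inner ℝ y v ≤ r := by
    intro z v r hq
    have h1 := hGK _ ((hK _).2 ⟨1, one_pos, _, hq, one_smul _ _⟩)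
    have e : ((z, v, r) : Z × Y × ℝ) = (z, 0, 0) + (0, v, 0) + (0, 0, r) := by simp
    rw [e, map_add, map_add, hGr, hGz] at h1
    rw [hψ]
    linarith
  refine ⟨y, ?_, fun v => ?_⟩
  · have h1 : ∀ z : Z, 0 ≤ inner ℝ (g + M.adjoint y) z := by
      intro z
      -- The perturbation `-M z` brings the argument of `P` back to `v₀`.
      have := hGC z (-M z) (inner ℝ g z) (by simp [C, hv₀, -EReal.coe_add, -EReal.coe_sub])
      rw [inner_add_left, ContinuousLinearMap.adjoint_inner_left]
      rw [inner_neg_right] at this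
      linarith
    have := h1 (-(g + M.adjoint y))
    rw [inner_neg_right, real_inner_self_eq_norm_sq] at this
    have h2 : ‖g + M.adjoint y‖ ^ 2 = 0 := le_antisymm (by linarith) (sq_nonneg _)
    simpa using h2
  · induction hv : P v with
    | bot => exact absurd hv (hP.ne_bot v)
    | top => simp
    | coe a =>
      have := hGC 0 (v - v₀) (a - c) (by simp [C, hv, -EReal.coe_add, -EReal.coe_sub])
      norm_cast
      linarith

end Multiplier

/-! ### The primal-dual optimality system -/

section Saddle

variable {Z Y : Type*}
  [NormedAddCommGroup Z] [InnerProductSpace ℝ Z] [CompleteSpace Z]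
  [NormedAddCommGroup Y] [InnerProductSpace ℝ Y] [CompleteSpace Y]

/-- The optimality system of the primal-dual pair: `∇h(z) + M^* y = 0`, and `M z - b` is a
subgradient of `P^*` at `y`, where `P^*` takes the real value `p`. -/
structure IsSaddle (h : Z → ℝ) (P : Y → EReal) (M : Z →L[ℝ] Y) (b : Y) (y : Y) (z : Z) (p : ℝ) :
    Prop where
  conj_eq : conj P y = p
  stationary : gradient h z + M.adjoint y = 0
  subgradient : ∀ (v : Y) (c : ℝ), conj P v ≤ (c : EReal) → p + inner ℝ (M z - b) (v - y) ≤ c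

variable {h : Z → ℝ} {P : Y → EReal} {M : Z →L[ℝ] Y} {b : Y}

lemma exists_isSaddle [FiniteDimensional ℝ Y] (hdiff : Differentiable ℝ h)
    (hP : IsProperClosedConvex P)
    (hopt : ∃ w : Z, ∀ u : Z, primalObj h P M b w ≤ primalObj h P M b u)
    (hCQ : ∃ w : Z, M w - b ∈ intrinsicInterior ℝ (effDom P)) :
    ∃ y z p, IsSaddle h P M b y z p := by
  obtain ⟨z, hz⟩ := hopt
  obtain ⟨w, hw⟩ := hCQ
  have htop : P (M z - b) ≠ ⊤ := by
    intro htop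
    have h1 := hz w
    have h2 : M w - b ∈ effDom P := intrinsicInterior_subset hw
    simp only [primalObj, htop, EReal.coe_add_top, top_le_iff] at h1
    exact EReal.add_ne_top (EReal.coe_ne_top _) (ne_of_lt h2) h1
  obtain ⟨c, hc⟩ : ∃ c : ℝ, P (M z - b) = c := ⟨_, (EReal.coe_toReal htop (hP.ne_bot _)).symm⟩
  -- Along a segment `P` lies below its chord, so differentiating at `s = 0` shows that `z` also
  -- minimizes the problem with `h` linearized at `z`.
  obtain ⟨y, hy, hsub⟩ := exists_multiplier hP M hc (gradient h z) (by
    intro d a ha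
    have h0 := (hasDerivAt_line hdiff z d 0).neg
    have := deriv_le_of_le_add_mul (C := a - c) h0 (fun s hs hs1 => by
      have h1 := hz (z + s • d)
      have h2 := hP.convex_epi (x := (M z - b, c)) hc.le (y := (M z - b + M d, a)) ha
        (sub_nonneg.2 hs1) hs.le (by ring)
      have e : (1 - s) • (M z - b) + s • (M z - b + M d) = M (z + s • d) - b := by
        rw [map_add, map_smul]; module
      have h2' : P (M (z + s • d) - b) ≤ (((1 - s) * c + s * a : ℝ) : EReal) := by
        rw [← e]; exact h2
      have h3 := h1.trans (add_le_add_right h2' _)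
      simp only [primalObj, hc] at h3
      norm_cast at h3
      simp
      linarith)
    simp only [zero_smul, add_zero] at this
    linarith) ⟨w - z, by
      have e : M z - b + M (w - z) = M w - b := by rw [map_sub]; abel
      rwa [e]⟩
  refine ⟨y, z, inner ℝ y (M z - b) - c, ⟨le_antisymm (conj_le_coe_iff.2 fun u => ?_) ?_, hy, ?_⟩⟩
  · have := hsub u
    rw [inner_sub_right y u] at this
    convert this using 2
    ring
  · have := le_iSup (fun u : Y => ((inner ℝ y u : ℝ) : EReal) - P u) (M z - b)
    simp only [hc] at this
    exact_mod_cast this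
  · intro v a hv
    have := conj_le_coe_iff.1 hv (M z - b)
    rw [hc] at this
    norm_cast at this
    rw [inner_sub_right (M z - b), real_inner_comm v, real_inner_comm y]
    linarith

/-- Fenchel equality holds at `M z - b` and Fenchel–Young at `M u - b`; stationarity cancels the
linear terms against the gradient inequality. -/
lemma IsSaddle.primal_optimal (hconv : ConvexOn ℝ univ h) (hdiff : Differentiable ℝ h)
    (hP : IsProperClosedConvex P) {y : Y} {z : Z} {p : ℝ} (hs : IsSaddle h P M b y z p) (u : Z) :
    primalObj h P M b z ≤ primalObj h P M b u := by
  have h1 := hP.le_of_subgradient_conj hs.conj_eq hs.subgradient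
  have h2 := conj_le_coe_iff.1 hs.conj_eq.le (M u - b)
  have h3 := gradient_ineq hconv hdiff z u
  have h4 : inner ℝ (gradient h z) (u - z) + inner ℝ y (M (u - z)) = 0 := by
    rw [← ContinuousLinearMap.adjoint_inner_left, ← inner_add_left, hs.stationary, inner_zero_left]
  calc primalObj h P M b z ≤ (h z : EReal) + ((inner ℝ y (M z - b) - p : ℝ) : EReal) :=
        add_le_add_right h1 _
    _ ≤ (h u : EReal) + ((inner ℝ y (M u - b) - p : ℝ) : EReal) := by
        norm_cast
        rw [map_sub, inner_sub_right] at h4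
        rw [inner_sub_right, inner_sub_right]
        rw [inner_sub_right] at h3 h4
        linarith
    _ ≤ primalObj h P M b u := add_le_add_right h2 _

/-- The dual value at a saddle point. -/
lemma IsSaddle.dualObj_eq (hconv : ConvexOn ℝ univ h) (hdiff : Differentiable ℝ h) {y : Y} {z : Z}
    {p : ℝ} (hs : IsSaddle h P M b y z p) :
    dualObj h P b (gradient h z) y
      = ((inner ℝ (gradient h z) z - h z + p + inner ℝ b y : ℝ) : EReal) := by
  rw [dualObj, conj_gradient hconv hdiff, hs.conj_eq]
  norm_cast

/-- The saddle-point lower bound on the dual objective, at points that need not be feasible. -/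
lemma IsSaddle.le_dualObj (hP : IsProperClosedConvex P) {y : Y} {z : Z} {p : ℝ}
    (hs : IsSaddle h P M b y z p) (x' : Z) (y' : Y) :
    ((inner ℝ (gradient h z) z - h z + p + inner ℝ b y
      + inner ℝ z (x' + M.adjoint y') : ℝ) : EReal) ≤ dualObj h P b x' y' := by
  have h1 : ((inner ℝ x' z - h z : ℝ) : EReal) ≤ conj (fun z => (h z : EReal)) x' := by
    exact_mod_cast le_iSup (fun u : Z => ((inner ℝ x' u : ℝ) : EReal) - (h u : EReal)) z
  rw [dualObj]
  induction hy' : conj P y' with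
  | bot => exact absurd hy' (conj_ne_bot hP.exists_ne_top y')
  | top =>
    rw [EReal.add_top_of_ne_bot (ne_bot_of_le_ne_bot (EReal.coe_ne_bot _) h1),
      EReal.top_add_coe]
    exact le_top
  | coe c =>
    have h2 := hs.subgradient y' c hy'.le
    refine le_trans ?_ (add_le_add_left (add_le_add_left h1 _) _)
    norm_cast
    have h3 : M.adjoint y = -gradient h z := by rw [eq_neg_iff_add_eq_zero, add_comm, hs.stationary]
    have h4 : inner ℝ (M z) y = -inner ℝ (gradient h z) z := by
      rw [← ContinuousLinearMap.adjoint_inner_right, h3, inner_neg_right, real_inner_comm]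
    rw [inner_add_right, ContinuousLinearMap.adjoint_inner_right, real_inner_comm z x']
    rw [inner_sub_left, inner_sub_right, inner_sub_right] at h2
    rw [real_inner_comm x' z] at *
    linarith

end Saddle

end PPG

/-! ### The one-step energy inequality -/

namespace PPG

lemma seminormOf_sq {E : Type*} [NormedAddCommGroup E] [InnerProductSpace ℝ E]
    {T : E →L[ℝ] E} {u : E} (h : 0 ≤ inner ℝ u (T u)) :
    seminormOf T u ^ 2 = inner ℝ u (T u) := Real.sq_sqrt h

/-- Used with `e = x^{t+1} - x'` and `d = M^* (y^{t+1} - y')`. Replacing `a` by `a'` in the first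
product costs `L⁻¹ ⟨e + d, e⟩`; with the strong convexity term and the `‖e + d‖²` from the
three-point identity it completes the square to `-‖d‖² / (2L)`. -/
lemma norm_sq_step_identity {E : Type*} [NormedAddCommGroup E] [InnerProductSpace ℝ E]
    {L : ℝ} (hL : 0 < L) {a a' w e d : E} (hstep : a - a' = L⁻¹ • (e + d)) :
    inner ℝ a e - 1 / (2 * L) * ‖e‖ ^ 2 + inner ℝ a' d - inner ℝ w (e + d) =
      L / 2 * ‖a - w‖ ^ 2 - L / 2 * ‖a' - w‖ ^ 2 - 1 / (2 * L) * ‖d‖ ^ 2 := by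
  obtain rfl : a' = a - L⁻¹ • (e + d) := by rw [← hstep]; abel
  have e1 : a - L⁻¹ • (e + d) - w = (a - w) - L⁻¹ • (e + d) := by abel
  rw [e1, norm_sub_sq_real (a - w), norm_smul, mul_pow, Real.norm_of_nonneg (inv_pos.2 hL).le,
    norm_add_sq_real]
  simp only [inner_sub_left, inner_add_right, inner_add_left, inner_smul_left, inner_smul_right,
    real_inner_self_eq_norm_sq, conj_trivial]
  field_simp
  ring

variable {Z Y : Type*}
  [NormedAddCommGroup Z] [InnerProductSpace ℝ Z] [CompleteSpace Z]
  [NormedAddCommGroup Y] [InnerProductSpace ℝ Y] [CompleteSpace Y]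

section ProxWeight

lemma inner_proxWeight (M : Z →L[ℝ] Y) (β τ : ℝ) (u v : Y) :
    inner ℝ u (proxWeight M β τ v) = τ * inner ℝ u v - β * inner ℝ (M.adjoint u) (M.adjoint v) := by
  simp only [proxWeight, sub_apply, smul_apply,
    ContinuousLinearMap.id_apply, ContinuousLinearMap.comp_apply, inner_sub_right,
    inner_smul_right, ContinuousLinearMap.adjoint_inner_left]

lemma inner_self_proxWeight (M : Z →L[ℝ] Y) (β τ : ℝ) (u : Y) :
    inner ℝ u (proxWeight M β τ u) = τ * ‖u‖ ^ 2 - β * ‖M.adjoint u‖ ^ 2 := by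
  rw [inner_proxWeight, real_inner_self_eq_norm_sq, real_inner_self_eq_norm_sq]

/-- This is where the choice of `τ` enters: `‖M^* M‖ = ‖M‖²` dominates `‖M^* u‖² / ‖u‖²`. -/
lemma proxWeight_nonneg (M : Z →L[ℝ] Y) {β : ℝ} (hβ : 0 ≤ β) (u : Y) :
    0 ≤ inner ℝ u (proxWeight M β (β * ‖M.adjoint ∘L M‖) u) := by
  rw [inner_self_proxWeight, M.norm_adjoint_comp_self, mul_assoc, ← mul_sub]
  refine mul_nonneg hβ (sub_nonneg.2 ?_)
  have h1 := M.adjoint.le_opNorm u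
  rw [LinearIsometryEquiv.norm_map] at h1
  calc ‖M.adjoint u‖ ^ 2 ≤ (‖M‖ * ‖u‖) ^ 2 := pow_le_pow_left₀ (norm_nonneg _) h1 2
    _ = ‖M‖ * ‖M‖ * ‖u‖ ^ 2 := by ring

lemma inner_proxWeight_three_point (M : Z →L[ℝ] Y) (β τ : ℝ) (u v w : Y) :
    2 * inner ℝ (proxWeight M β τ (u - v)) (v - w) =
      inner ℝ (u - w) (proxWeight M β τ (u - w)) - inner ℝ (v - w) (proxWeight M β τ (v - w))
        - inner ℝ (u - v) (proxWeight M β τ (u - v)) := by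
  have e : u - w = (u - v) + (v - w) := by abel
  rw [e]
  generalize u - v = r
  generalize v - w = s
  rw [real_inner_comm]
  simp only [inner_proxWeight, map_add, inner_add_left, inner_add_right]
  rw [real_inner_comm r s, real_inner_comm (M.adjoint r) (M.adjoint s)]
  ring

end ProxWeight

section Iteration

variable {h : Z → ℝ} {P : Y → EReal} {M : Z →L[ℝ] Y} {b : Y} {L τ : ℝ}
  {y : ℕ → Y} {z : ℕ → Z} {p : ℕ → ℝ}

/-- The optimality conditions of the steps of the algorithm; `p t` is the value of `P^*` at
`y (t + 1)`. -/
structure IsIteration (h : Z → ℝ) (P : Y → EReal) (M : Z →L[ℝ] Y) (b : Y) (L τ : ℝ)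
    (y : ℕ → Y) (z : ℕ → Z) (p : ℕ → ℝ) : Prop where
  conj_eq : ∀ t, conj P (y (t + 1)) = p t
  subgradient : ∀ t (v : Y) (c : ℝ), conj P v ≤ (c : EReal) →
    p t + inner ℝ (M (z (t + 1)) - b + proxWeight M (1 / L) τ (y t - y (t + 1))) (v - y (t + 1)) ≤ c
  step : ∀ t, z t - z (t + 1) = L⁻¹ • (gradient h (z t) + M.adjoint (y (t + 1)))

/-- Substituting the `z`-step into the prox condition moves `-β M M^* y^{t+1}` into `M z^{t+1}`. A
point where `P^*` is finite rules out an infinite value at a minimizer of the prox objective. -/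
lemma IsPPG.exists_isIteration (hP : IsProperClosedConvex P) (hτ : 0 < τ)
    (hPPG : IsPPG h P M b (1 / L) τ 1 y z) {v : Y} {c : ℝ} (hv : conj P v = c) :
    ∃ p, IsIteration h P M b L τ y z p := by
  have hbot := conj_ne_bot hP.exists_ne_top
  have htop : ∀ t, conj P (y (t + 1)) ≠ ⊤ := by
    intro t ht
    have h1 := hPPG.y_step t v
    simp only [ht, hv] at h1
    rw [EReal.coe_mul_top_of_pos (inv_pos.2 hτ), EReal.top_add_coe, top_le_iff] at h1
    exact EReal.coe_ne_top (τ⁻¹ * c + _) (by exact_mod_cast h1)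
  have hstep : ∀ t, z t - z (t + 1) = L⁻¹ • (gradient h (z t) + M.adjoint (y (t + 1))) := by
    intro t
    rw [hPPG.z_step t, one_mul, one_div, sub_sub_cancel]
  refine ⟨fun t => (conj P (y (t + 1))).toReal,
    fun t => (EReal.coe_toReal (htop t) (hbot _)).symm, fun t w a hw => ?_, hstep⟩
  have h1 := (hPPG.y_step t).subgradient hτ (EReal.coe_toReal (htop t) (hbot _)).symm hw hbot
  convert h1 using 4
  have e : M (z (t + 1)) = M (z t) - L⁻¹ • (M (gradient h (z t)) + M (M.adjoint (y (t + 1)))) := by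
    rw [← map_add, ← map_smul, ← hstep, ← map_sub, sub_sub_cancel]
  rw [smul_sub, smul_inv_smul₀ hτ.ne', map_sub, e]
  simp only [proxWeight, sub_apply, smul_apply,
    ContinuousLinearMap.id_apply, ContinuousLinearMap.comp_apply]
  rw [one_div]
  module

/-- The energy `L ‖z - w‖² + ‖y - v‖_T²`. -/
noncomputable def energy (M : Z →L[ℝ] Y) (L τ : ℝ) (v : Y) (w : Z) (y : Y) (z : Z) : ℝ :=
  L * ‖z - w‖ ^ 2 + inner ℝ (y - v) (proxWeight M (1 / L) τ (y - v))

/-- One step of the algorithm, compared with a dual feasible point. -/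
lemma IsIteration.gap_le (hit : IsIteration h P M b L τ y z p) (hL : 0 < L)
    (hdiff : Differentiable ℝ h)
    (hLip : ∀ u v : Z, ‖gradient h u - gradient h v‖ ≤ L * ‖u - v‖) {x' : Z} {y' : Y} {k c : ℝ}
    (hx' : conj (fun z => (h z : EReal)) x' ≤ (k : EReal)) (hy' : conj P y' ≤ (c : EReal))
    (hfeas : x' + M.adjoint y' = 0) (w : Z) (t : ℕ) :
    2 * ((inner ℝ (gradient h (z t)) (z t) - h (z t) + p t + inner ℝ b (y (t + 1)))
        - (k + c + inner ℝ b y')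
        - inner ℝ w (gradient h (z t) + M.adjoint (y (t + 1))))
      + energy M L τ y' w (y (t + 1)) (z (t + 1))
      + inner ℝ (y t - y (t + 1)) (proxWeight M (1 / L) τ (y t - y (t + 1)))
      + 1 / L * ‖M.adjoint (y (t + 1) - y')‖ ^ 2
      ≤ energy M L τ y' w (y t) (z t) := by
  have hA := conj_ge_of_lipschitz hL hdiff hLip (z t) x' hx'
  have hB := hit.subgradient t y' c hy'
  have hT := inner_proxWeight_three_point M (1 / L) τ (y t) (y (t + 1)) y'
  have hr : gradient h (z t) + M.adjoint (y (t + 1))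
      = (gradient h (z t) - x') + M.adjoint (y (t + 1) - y') := by
    rw [map_sub, eq_neg_of_add_eq_zero_left hfeas]; abel
  have hstep := hit.step t
  rw [hr] at hstep
  have hid := norm_sq_step_identity (w := w) hL hstep
  rw [hr]
  unfold energy
  rw [← neg_sub (y (t + 1)) y', inner_neg_right, inner_add_left, inner_sub_left (M _),
    ← ContinuousLinearMap.adjoint_inner_right, inner_sub_right b] at hB
  rw [← neg_sub (gradient h (z t)) x', inner_neg_right, norm_neg] at hA
  have e : 1 / L * ‖M.adjoint (y (t + 1) - y')‖ ^ 2
    = 2 * (1 / (2 * L) * ‖M.adjoint (y (t + 1) - y')‖ ^ 2) := by field_simp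
  rw [e]
  linarith

variable {y' : Y} {z' : Z} {p' : ℝ}

/-- `gap_le` at a saddle with `w = z'`: strong convexity of `h^*` makes the Lagrangian gap at least
`‖∇h(z^t) - ∇h(z')‖² / (2L)`. -/
lemma IsIteration.energy_step (hit : IsIteration h P M b L τ y z p) (hL : 0 < L)
    (hconv : ConvexOn ℝ univ h) (hdiff : Differentiable ℝ h)
    (hLip : ∀ u v : Z, ‖gradient h u - gradient h v‖ ≤ L * ‖u - v‖)
    (hs : IsSaddle h P M b y' z' p') (t : ℕ) :
    energy M L τ y' z' (y (t + 1)) (z (t + 1))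
      + inner ℝ (y t - y (t + 1)) (proxWeight M (1 / L) τ (y t - y (t + 1)))
      + 1 / L * ‖M.adjoint (y (t + 1) - y')‖ ^ 2
      + 1 / L * ‖gradient h (z t) - gradient h z'‖ ^ 2
      ≤ energy M L τ y' z' (y t) (z t) := by
  have h1 := hit.gap_le hL hdiff hLip (conj_gradient hconv hdiff z').le hs.conj_eq.le
    hs.stationary z' t
  have h2 := conj_ge_of_lipschitz hL hdiff hLip z' _ (conj_gradient hconv hdiff (z t)).le
  have h3 := hs.subgradient _ _ (hit.conj_eq t).le
  have hr : gradient h (z t) + M.adjoint (y (t + 1))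
      = (gradient h (z t) - gradient h z') + M.adjoint (y (t + 1) - y') := by
    rw [map_sub, eq_neg_of_add_eq_zero_left hs.stationary]; abel
  rw [hr, inner_add_right z'] at h1
  rw [inner_sub_left, ← ContinuousLinearMap.adjoint_inner_right, inner_sub_right b] at h3
  have e : 1 / L * ‖gradient h (z t) - gradient h z'‖ ^ 2
    = 2 * (1 / (2 * L) * ‖gradient h (z t) - gradient h z'‖ ^ 2) := by field_simp
  rw [e]
  linarith

end Iteration

end PPG

namespace PPG

variable {Z Y : Type*}
  [NormedAddCommGroup Z] [InnerProductSpace ℝ Z] [CompleteSpace Z]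
  [NormedAddCommGroup Y] [InnerProductSpace ℝ Y] [CompleteSpace Y]
  {h : Z → ℝ} {P : Y → EReal} {M : Z →L[ℝ] Y} {b : Y} {L τ : ℝ}
  {y : ℕ → Y} {z : ℕ → Z} {p : ℕ → ℝ} {y' : Y} {z' : Z} {p' : ℝ}

/-! ### Convergence of the iterates -/

section Convergence

lemma tendsto_of_norm_sub_sq_le {E : Type*} [NormedAddCommGroup E] {u : ℕ → E} {v : E} {a : ℕ → ℝ}
    {c : ℝ} (hc : 0 < c) (ha : Tendsto a atTop (𝓝 0)) (hle : ∀ n, c * ‖u n - v‖ ^ 2 ≤ a n) :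
    Tendsto u atTop (𝓝 v) := by
  rw [tendsto_iff_norm_sub_tendsto_zero]
  have h1 : Tendsto (fun n => √(c⁻¹ * a n)) atTop (𝓝 0) := by
    have := (ha.const_mul c⁻¹).sqrt
    simpa using this
  refine squeeze_zero (fun n => norm_nonneg _) (fun n => ?_) h1
  refine Real.le_sqrt_of_sq_le ?_
  rw [le_inv_mul_iff₀ hc]
  exact hle n

lemma energy_nonneg (hL : 0 < L) (hq : ∀ u, 0 ≤ inner ℝ u (proxWeight M (1 / L) τ u))
    (v : Y) (w : Z) (u : Y) (x : Z) : 0 ≤ energy M L τ v w u x :=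
  add_nonneg (by positivity) (hq _)

lemma IsIteration.antitone_energy (hit : IsIteration h P M b L τ y z p) (hL : 0 < L)
    (hconv : ConvexOn ℝ univ h) (hdiff : Differentiable ℝ h)
    (hLip : ∀ u v : Z, ‖gradient h u - gradient h v‖ ≤ L * ‖u - v‖)
    (hq : ∀ u, 0 ≤ inner ℝ u (proxWeight M (1 / L) τ u))
    (hs : IsSaddle h P M b y' z' p') :
    Antitone fun t => energy M L τ y' z' (y t) (z t) := by
  refine antitone_nat_of_succ_le fun t => ?_
  have h1 := hit.energy_step hL hconv hdiff hLip hs t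
  have h2 := hq (y t - y (t + 1))
  have h3 : 0 ≤ 1 / L * ‖M.adjoint (y (t + 1) - y')‖ ^ 2 := by positivity
  have h4 : 0 ≤ 1 / L * ‖gradient h (z t) - gradient h z'‖ ^ 2 := by positivity
  linarith

/-- The asymptotic regularity of the iteration. -/
lemma IsIteration.tendsto_residuals (hit : IsIteration h P M b L τ y z p) (hL : 0 < L)
    (hconv : ConvexOn ℝ univ h) (hdiff : Differentiable ℝ h)
    (hLip : ∀ u v : Z, ‖gradient h u - gradient h v‖ ≤ L * ‖u - v‖)
    (hq : ∀ u, 0 ≤ inner ℝ u (proxWeight M (1 / L) τ u))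
    (hs : IsSaddle h P M b y' z' p') :
    Tendsto (fun t => gradient h (z t)) atTop (𝓝 (gradient h z')) ∧
      Tendsto (fun t => M.adjoint (y t)) atTop (𝓝 (M.adjoint y')) ∧
      Tendsto (fun t => inner ℝ (y t - y (t + 1)) (proxWeight M (1 / L) τ (y t - y (t + 1))))
        atTop (𝓝 0) := by
  set E := fun t => energy M L τ y' z' (y t) (z t) with hE
  have hanti : Antitone E := hit.antitone_energy hL hconv hdiff hLip hq hs
  have hlim := tendsto_atTop_ciInf hanti ⟨0, by
    rintro _ ⟨t, rfl⟩; exact energy_nonneg hL hq _ _ _ _⟩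
  have hdiff0 : Tendsto (fun t => E t - E (t + 1)) atTop (𝓝 0) := by
    simpa using hlim.sub (hlim.comp (tendsto_add_atTop_nat 1))
  have hstep := fun t => hit.energy_step hL hconv hdiff hLip hs t
  have h2 := fun t => hq (y t - y (t + 1))
  have h3 : ∀ t, 0 ≤ 1 / L * ‖M.adjoint (y (t + 1) - y')‖ ^ 2 := fun t => by positivity
  have h4 : ∀ t, 0 ≤ 1 / L * ‖gradient h (z t) - gradient h z'‖ ^ 2 := fun t => by positivity
  refine ⟨tendsto_of_norm_sub_sq_le (one_div_pos.2 hL) hdiff0 fun t => ?_,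
    (tendsto_add_atTop_iff_nat 1).1
      (tendsto_of_norm_sub_sq_le (one_div_pos.2 hL) hdiff0 fun t => ?_),
    squeeze_zero h2 (fun t => ?_) hdiff0⟩
  · simp only [hE]
    linarith [hstep t, h2 t, h3 t]
  · simp only [hE]
    rw [← map_sub]
    linarith [hstep t, h2 t, h4 t]
  · simp only [hE]
    linarith [hstep t, h3 t, h4 t]

/-- A Fejér monotonicity argument. Since `T` is only semidefinite, the energy alone does not control
`y`; the identity `τ ‖u‖² = ‖u‖_T² + ‖M^* u‖² / L` and the convergence of `M^* y^t` supply the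
missing part. -/
lemma IsIteration.exists_tendsto [FiniteDimensional ℝ Z] [FiniteDimensional ℝ Y]
    (hit : IsIteration h P M b L τ y z p) (hL : 0 < L) (hτ : 0 < τ)
    (hconv : ConvexOn ℝ univ h) (hdiff : Differentiable ℝ h)
    (hLip : ∀ u v : Z, ‖gradient h u - gradient h v‖ ≤ L * ‖u - v‖)
    (hP : IsProperClosedConvex P)
    (hq : ∀ u, 0 ≤ inner ℝ u (proxWeight M (1 / L) τ u))
    (hs : IsSaddle h P M b y' z' p') :
    ∃ ybar zbar pbar, IsSaddle h P M b ybar zbar pbar ∧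
      Tendsto y atTop (𝓝 ybar) ∧ Tendsto z atTop (𝓝 zbar) := by
  have hgcont : Continuous (gradient h) :=
    (LipschitzWith.of_dist_le_mul (K := ⟨L, hL.le⟩) fun u v => by
      rw [dist_eq_norm, dist_eq_norm]; exact hLip u v).continuous
  obtain ⟨hx, hMy, hdq⟩ := hit.tendsto_residuals hL hconv hdiff hLip hq hs
  have hτn : ∀ u : Y, τ * ‖u‖ ^ 2 =
      inner ℝ u (proxWeight M (1 / L) τ u) + 1 / L * ‖M.adjoint u‖ ^ 2 := fun u => by
    rw [inner_self_proxWeight]; ring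
  have hdy : Tendsto (fun t => y t - y (t + 1)) atTop (𝓝 0) := by
    have h1 : Tendsto (fun t => M.adjoint (y t - y (t + 1))) atTop (𝓝 0) := by
      simpa using hMy.sub (hMy.comp (tendsto_add_atTop_nat 1))
    have h2 := hdq.add ((h1.norm.pow 2).const_mul (1 / L))
    simp only [norm_zero, ne_eq, OfNat.ofNat_ne_zero, not_false_eq_true, zero_pow, mul_zero,
      add_zero] at h2
    refine tendsto_of_norm_sub_sq_le hτ h2 fun t => ?_
    rw [sub_zero, hτn]
  -- the iterates are bounded
  set R := energy M L τ y' z' (y 0) (z 0) with hR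
  have hbound : ∀ t, energy M L τ y' z' (y t) (z t) ≤ R := fun t =>
    hit.antitone_energy hL hconv hdiff hLip hq hs (Nat.zero_le t)
  -- The index is shifted because the energy step bounds `M^* (y^{t+1} - y')`. In the first radius,
  -- each of the two parts of `τ ‖u‖²` is at most `R`.
  have hball : ∀ t, (y (t + 1), z (t + 1)) ∈
      Metric.closedBall y' √(τ⁻¹ * (2 * R)) ×ˢ Metric.closedBall z' √(L⁻¹ * R) := by
    intro t
    have h1 := hbound (t + 1)
    have h2 := hit.energy_step hL hconv hdiff hLip hs t
    have h3 := hbound t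
    have h4 := hq (y t - y (t + 1))
    have h5 : 0 ≤ 1 / L * ‖gradient h (z t) - gradient h z'‖ ^ 2 := by positivity
    have h6 := energy_nonneg hL hq y' z' (y (t + 1)) (z (t + 1))
    have h7 := hq (y (t + 1) - y')
    have h8 : 0 ≤ L * ‖z (t + 1) - z'‖ ^ 2 := by positivity
    rw [mem_prod, mem_closedBall_iff_norm, mem_closedBall_iff_norm]
    constructor
    · refine Real.le_sqrt_of_sq_le ?_
      rw [le_inv_mul_iff₀ hτ, hτn]
      unfold energy at *
      linarith
    · refine Real.le_sqrt_of_sq_le ?_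
      rw [le_inv_mul_iff₀ hL]
      unfold energy at h1
      linarith
  obtain ⟨⟨ybar, zbar⟩, -, φ, hφ, hlim⟩ := tendsto_subseq_of_bounded
    (Metric.isBounded_closedBall.prod Metric.isBounded_closedBall) hball
  have hy1 : Tendsto (fun j => y (φ j + 1)) atTop (𝓝 ybar) :=
    (continuous_fst.tendsto _).comp hlim
  have hz1 : Tendsto (fun j => z (φ j + 1)) atTop (𝓝 zbar) :=
    (continuous_snd.tendsto _).comp hlim
  have hφt := hφ.tendsto_atTop
  have hφt1 : Tendsto (fun j => φ j + 1) atTop atTop := (tendsto_add_atTop_nat 1).comp hφt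
  have hgrad : gradient h zbar = gradient h z' :=
    tendsto_nhds_unique ((hgcont.tendsto zbar).comp hz1) (hx.comp hφt1)
  have hadj : M.adjoint ybar = M.adjoint y' :=
    tendsto_nhds_unique ((M.adjoint.continuous.tendsto ybar).comp hy1) (hMy.comp hφt1)
  have hsublim : Tendsto (fun j => M (z (φ j + 1)) - b
      + proxWeight M (1 / L) τ (y (φ j) - y (φ j + 1))) atTop (𝓝 (M zbar - b)) := by
    have h1 := ((proxWeight M (1 / L) τ).continuous.tendsto 0).comp (hdy.comp hφt)
    have h2 := (((M.continuous.tendsto zbar).comp hz1).sub_const b).add h1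
    simpa using h2
  -- Closedness of the epigraph of `P^*` carries the subgradient inequality to the cluster point.
  have hconj : ∀ (v : Y) (c : ℝ), conj P v ≤ (c : EReal) →
      conj P ybar ≤ ((c - inner ℝ (M zbar - b) (v - ybar) : ℝ) : EReal) := by
    intro v c hv
    refine conj_le_of_tendsto hy1 ((hsublim.inner (hy1.const_sub v)).const_sub c) fun j => ?_
    rw [hit.conj_eq]
    have := hit.subgradient (φ j) v c hv
    exact_mod_cast (by linarith)
  obtain ⟨pbar, hpbar⟩ : ∃ r : ℝ, conj P ybar = r :=
    ⟨_, (EReal.coe_toReal (ne_top_of_le_ne_top (EReal.coe_ne_top _) (hconj y' p' hs.conj_eq.le))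
      (conj_ne_bot hP.exists_ne_top _)).symm⟩
  have hsaddle : IsSaddle h P M b ybar zbar pbar := by
    refine ⟨hpbar, by rw [hgrad, hadj, hs.stationary], fun v c hv => ?_⟩
    have := hconj v c hv
    rw [hpbar] at this
    norm_cast at this
    linarith
  refine ⟨ybar, zbar, pbar, hsaddle, ?_⟩
  -- the energy with respect to the limit point tends to zero
  have hanti := hit.antitone_energy hL hconv hdiff hLip hq hsaddle
  have hlimE := tendsto_atTop_ciInf hanti ⟨0, by
    rintro _ ⟨t, rfl⟩; exact energy_nonneg hL hq _ _ _ _⟩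
  have hsubE : Tendsto (fun j => energy M L τ ybar zbar (y (φ j + 1)) (z (φ j + 1))) atTop
      (𝓝 0) := by
    have h1 := hy1.sub_const ybar
    have h2 := ((hz1.sub_const zbar).norm.pow 2).const_mul L
    have h3 := h2.add (h1.inner (((proxWeight M (1 / L) τ).continuous.tendsto _).comp h1))
    simp only [sub_self, norm_zero, ne_eq, OfNat.ofNat_ne_zero, not_false_eq_true, zero_pow,
      mul_zero, inner_zero_left, add_zero] at h3
    exact h3
  have hE0 := tendsto_nhds_unique (hlimE.comp hφt1) hsubE
  rw [hE0] at hlimE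
  constructor
  · have h1 := ((hMy.sub_const (M.adjoint ybar)).norm.pow 2).const_mul (1 / L)
    rw [hadj] at h1
    have h2 := hlimE.add h1
    simp only [sub_self, norm_zero, ne_eq, OfNat.ofNat_ne_zero, not_false_eq_true, zero_pow,
      mul_zero, add_zero] at h2
    refine tendsto_of_norm_sub_sq_le hτ h2 fun t => ?_
    rw [hτn, M.adjoint.map_sub, hadj]
    unfold energy
    have : 0 ≤ L * ‖z t - zbar‖ ^ 2 := by positivity
    linarith
  · refine tendsto_of_norm_sub_sq_le hL hlimE fun t => ?_
    unfold energy
    linarith [hq (y t - ybar)]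

end Convergence

/-! ### Ergodic bounds -/

section Ergodic

lemma sum_Icc_one_eq_sum_range {E : Type*} [AddCommMonoid E] (f : ℕ → E) (N : ℕ) :
    ∑ t ∈ Finset.Icc 1 N, f t = ∑ t ∈ Finset.range N, f (t + 1) := by
  rw [Finset.range_eq_Ico, Finset.sum_Ico_add' f 0 N 1]
  rfl

variable {x : ℕ → Z}

lemma IsIteration.ergodicAvg_residual (hit : IsIteration h P M b L τ y z p) (hL : 0 < L)
    (hx : ∀ t : ℕ, x (t + 1) = gradient h (z t)) (N : ℕ) :
    ergodicAvg x N + M.adjoint (ergodicAvg y N) = (L / N) • (z 0 - z N) := by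
  have h1 : ∀ t, x (t + 1) + M.adjoint (y (t + 1)) = L • (z t - z (t + 1)) := fun t => by
    rw [hit.step, smul_inv_smul₀ hL.ne', hx]
  rw [ergodicAvg, ergodicAvg, map_smul, ← smul_add, map_sum, ← Finset.sum_add_distrib,
    sum_Icc_one_eq_sum_range, Finset.sum_congr rfl fun t _ => h1 t, ← Finset.smul_sum,
    Finset.sum_range_sub', smul_smul]
  congr 1
  ring

lemma IsIteration.norm_residual_le (hit : IsIteration h P M b L τ y z p) (hL : 0 < L)
    (hconv : ConvexOn ℝ univ h) (hdiff : Differentiable ℝ h)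
    (hLip : ∀ u v : Z, ‖gradient h u - gradient h v‖ ≤ L * ‖u - v‖)
    (hq : ∀ u, 0 ≤ inner ℝ u (proxWeight M (1 / L) τ u))
    (hs : IsSaddle h P M b y' z' p') (hx : ∀ t : ℕ, x (t + 1) = gradient h (z t))
    {N : ℕ} (hN : 1 ≤ N) :
    ‖ergodicAvg x N + M.adjoint (ergodicAvg y N)‖
      ≤ 2 * √(L / N) * √(energy M L τ y' z' (y 0) (z 0)) := by
  have hN1 : (1 : ℝ) ≤ N := by exact_mod_cast hN
  have hN0 : (0 : ℝ) < N := by linarith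
  set R := energy M L τ y' z' (y 0) (z 0) with hR
  have hz : ∀ t, ‖z t - z'‖ ≤ √(R / L) := by
    intro t
    have h1 : energy M L τ y' z' (y t) (z t) ≤ R :=
      hit.antitone_energy hL hconv hdiff hLip hq hs (Nat.zero_le t)
    refine Real.le_sqrt_of_sq_le ?_
    rw [le_div_iff₀ hL]
    unfold energy at h1
    linarith [hq (y t - y')]
  have hdist : ‖z 0 - z N‖ ≤ 2 * √(R / L) := by
    have := norm_sub_le_norm_sub_add_norm_sub (z 0) z' (z N)
    have h1 := hz N
    rw [norm_sub_rev] at h1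
    linarith [hz 0]
  have hLN : 0 ≤ L / N := by positivity
  rw [hit.ergodicAvg_residual hL hx, norm_smul, Real.norm_of_nonneg hLN]
  -- The telescoped residual is of order `1/N`; here `N ≥ 1` weakens it to `1/√N`.
  have hfac : L / N * √(R / L) ≤ √(L / N) * √R := by
    have e : L / N * √(R / L) = √(L / N) * √(R / N) := by
      rw [← Real.sqrt_mul hLN, show L / N * (R / N) = (L / N) ^ 2 * (R / L) by field_simp,
        Real.sqrt_mul (sq_nonneg _), Real.sqrt_sq hLN]
    rw [e]
    refine mul_le_mul_of_nonneg_left (Real.sqrt_le_sqrt ?_) (Real.sqrt_nonneg _)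
    exact div_le_self (energy_nonneg hL hq _ _ _ _) hN1
  calc L / N * ‖z 0 - z N‖ ≤ L / N * (2 * √(R / L)) := mul_le_mul_of_nonneg_left hdist hLN
    _ = 2 * (L / N * √(R / L)) := by ring
    _ ≤ 2 * (√(L / N) * √R) := by linarith
    _ = 2 * √(L / N) * √R := by ring

lemma IsIteration.dualObj_ergodicAvg_le (hit : IsIteration h P M b L τ y z p) (hL : 0 < L)
    (hconv : ConvexOn ℝ univ h) (hdiff : Differentiable ℝ h)
    (hLip : ∀ u v : Z, ‖gradient h u - gradient h v‖ ≤ L * ‖u - v‖)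
    (hq : ∀ u, 0 ≤ inner ℝ u (proxWeight M (1 / L) τ u))
    (hs : IsSaddle h P M b y' z' p') (hx : ∀ t : ℕ, x (t + 1) = gradient h (z t))
    {N : ℕ} (hN : 1 ≤ N) :
    dualObj h P b (ergodicAvg x N) (ergodicAvg y N)
      ≤ ((inner ℝ (gradient h z') z' - h z' + p' + inner ℝ b y'
        + 1 / (2 * N) * energy M L τ y' 0 (y 0) (z 0) : ℝ) : EReal) := by
  have hN0 : (0 : ℝ) < N := by exact_mod_cast hN
  -- The value of `h^*` at `x^t = ∇h(z^{t-1})`; only `t ≥ 1` occurs, so the truncated subtraction is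
  -- harmless.
  set k : ℕ → ℝ := fun t => inner ℝ (gradient h (z (t - 1))) (z (t - 1)) - h (z (t - 1)) with hk
  have h1 : conj (fun z => (h z : EReal)) (ergodicAvg x N)
      ≤ ((1 / (N : ℝ) * ∑ t ∈ Finset.Icc 1 N, k t : ℝ) : EReal) := by
    refine conj_avg_le x k hN fun t ht => ?_
    obtain ⟨s, rfl⟩ := Nat.exists_eq_add_of_le' (Finset.mem_Icc.1 ht).1
    rw [hx, conj_gradient hconv hdiff]
    rfl
  have h2 : conj P (ergodicAvg y N)
      ≤ ((1 / (N : ℝ) * ∑ t ∈ Finset.Icc 1 N, p (t - 1) : ℝ) : EReal) := by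
    refine conj_avg_le y (fun t => p (t - 1)) hN fun t ht => ?_
    obtain ⟨s, rfl⟩ := Nat.exists_eq_add_of_le' (Finset.mem_Icc.1 ht).1
    rw [hit.conj_eq]
    rfl
  refine (add_le_add_left (add_le_add h1 h2) _).trans ?_
  norm_cast
  push_cast
  set d := inner ℝ (gradient h z') z' - h z' + p' + inner ℝ b y' with hd
  -- Taking `w = 0` removes the residual term, leaving a telescoping bound on the dual value.
  have hgap : ∀ t, k (t + 1) + p t + inner ℝ b (y (t + 1)) ≤
      d + 1 / 2 * (energy M L τ y' 0 (y t) (z t)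
        - energy M L τ y' 0 (y (t + 1)) (z (t + 1))) := by
    intro t
    have h3 := hit.gap_le hL hdiff hLip (conj_gradient hconv hdiff z').le hs.conj_eq.le
      hs.stationary 0 t
    have h4 := hq (y t - y (t + 1))
    have h5 : 0 ≤ 1 / L * ‖M.adjoint (y (t + 1) - y')‖ ^ 2 := by positivity
    rw [inner_zero_left] at h3
    simp only [hk, hd, Nat.add_sub_cancel]
    linarith
  have hsum := Finset.sum_le_sum (s := Finset.range N) fun t _ => hgap t
  rw [Finset.sum_add_distrib, Finset.sum_add_distrib, Finset.sum_add_distrib, ← Finset.mul_sum,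
    Finset.sum_range_sub' (fun t => energy M L τ y' 0 (y t) (z t)), Finset.sum_const,
    Finset.card_range, nsmul_eq_mul] at hsum
  rw [sum_Icc_one_eq_sum_range, sum_Icc_one_eq_sum_range, ergodicAvg, inner_smul_right, inner_sum,
    sum_Icc_one_eq_sum_range, ← mul_add, ← mul_add, one_div, inv_mul_le_iff₀ hN0]
  have h6 := energy_nonneg hL hq y' 0 (y N) (z N)
  have e : (N : ℝ) * (d + 1 / (2 * N) * energy M L τ y' 0 (y 0) (z 0))
      = N * d + 1 / 2 * energy M L τ y' 0 (y 0) (z 0) := by field_simp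
  rw [e]
  simp only [Nat.add_sub_cancel]
  linarith

end Ergodic

end PPG

/-! ### The main theorem -/

theorem corollary4p1 {Z Y : Type*}
    [NormedAddCommGroup Z] [InnerProductSpace ℝ Z] [FiniteDimensional ℝ Z] [CompleteSpace Z]
    [NormedAddCommGroup Y] [InnerProductSpace ℝ Y] [FiniteDimensional ℝ Y] [CompleteSpace Y]
    (h : Z → ℝ) (P : Y → EReal) (M : Z →L[ℝ] Y) (b : Y) (L : ℝ)
    (hconv : ConvexOn ℝ Set.univ h) (hdiff : Differentiable ℝ h)
    (hL : 0 < L) (hLip : ∀ u v : Z, ‖gradient h u - gradient h v‖ ≤ L * ‖u - v‖)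
    (hP : PPG.IsProperClosedConvex P) (hM : M ≠ 0)
    -- the primal problem has an optimal solution
    (hopt : ∃ w : Z, ∀ u : Z, PPG.primalObj h P M b w ≤ PPG.primalObj h P M b u)
    -- constraint qualification: `(Range M - b) ∩ ri (dom P) ≠ ∅`
    (hCQ : ∃ w : Z, M w - b ∈ intrinsicInterior ℝ (PPG.effDom P))
    (β τ : ℝ) (hβ : β = 1 / L) (hτ : τ = β * ‖M.adjoint ∘L M‖)
    (x : ℕ → Z) (y : ℕ → Y) (z : ℕ → Z)
    (hPPG : PPG.IsPPG h P M b β τ 1 y z)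
    (hx : ∀ t : ℕ, x (t + 1) = gradient h (z t)) :
    ∃ (xbar : Z) (ybar : Y) (zbar : Z),
      -- `(xbar, ybar, zbar)` is the limit of the iterates
      Tendsto x atTop (𝓝 xbar) ∧ Tendsto y atTop (𝓝 ybar) ∧ Tendsto z atTop (𝓝 zbar) ∧
      -- `(xbar, ybar)` solves the dual problem and `zbar` solves the primal problem
      xbar + M.adjoint ybar = 0 ∧
      (∀ (u : Z) (v : Y), u + M.adjoint v = 0 →
        PPG.dualObj h P b xbar ybar ≤ PPG.dualObj h P b u v) ∧
      (∀ u : Z, PPG.primalObj h P M b zbar ≤ PPG.primalObj h P M b u) ∧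
      -- the dual optimal value is a real number
      PPG.dualObj h P b xbar ybar ≠ ⊤ ∧ PPG.dualObj h P b xbar ybar ≠ ⊥ ∧
      ∀ N : ℕ, 1 ≤ N →
        -- lower bound on the dual objective gap
        ((-(2 * ‖zbar‖ * √(L / N) *
            √(L * ‖z 0 - zbar‖ ^ 2 +
              PPG.seminormOf (PPG.proxWeight M β τ) (y 0 - ybar) ^ 2)) : ℝ) : EReal) ≤
          PPG.dualObj h P b (PPG.ergodicAvg x N) (PPG.ergodicAvg y N)
            - PPG.dualObj h P b xbar ybar ∧
        -- upper bound on the dual objective gap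
        PPG.dualObj h P b (PPG.ergodicAvg x N) (PPG.ergodicAvg y N)
            - PPG.dualObj h P b xbar ybar ≤
          ((1 / (2 * N) * (L * ‖z 0‖ ^ 2 +
              PPG.seminormOf (PPG.proxWeight M β τ) (y 0 - ybar) ^ 2) +
            1 / N * (L * ‖z 0 - zbar‖ ^ 2 +
              PPG.seminormOf (PPG.proxWeight M β τ) (y 0 - ybar) ^ 2) : ℝ) : EReal) ∧
        -- bound on the dual feasibility residual
        ‖PPG.ergodicAvg x N + M.adjoint (PPG.ergodicAvg y N)‖ ≤
          2 * √(L / N) *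
            √(L * ‖z 0 - zbar‖ ^ 2 +
              PPG.seminormOf (PPG.proxWeight M β τ) (y 0 - ybar) ^ 2) := by
  subst hβ hτ
  have hq := PPG.proxWeight_nonneg M (one_div_pos.2 hL).le
  have hτ : 0 < 1 / L * ‖M.adjoint ∘L M‖ := by
    rw [M.norm_adjoint_comp_self]
    have := norm_pos_iff.2 hM
    positivity
  obtain ⟨y', z', p', hs'⟩ := PPG.exists_isSaddle hdiff hP hopt hCQ
  obtain ⟨p, hit⟩ := hPPG.exists_isIteration hP hτ hs'.conj_eq
  obtain ⟨ybar, zbar, pbar, hs, hy, hz⟩ := hit.exists_tendsto hL hτ hconv hdiff hLip hP hq hs'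
  have hxlim : Tendsto x atTop (𝓝 (gradient h zbar)) := by
    -- `x 0` is arbitrary, so the limit is taken from index one on.
    refine (tendsto_add_atTop_iff_nat 1).1 ?_
    simp only [hx]
    exact (hit.tendsto_residuals hL hconv hdiff hLip hq hs).1
  have hD := hs.dualObj_eq hconv hdiff
  refine ⟨gradient h zbar, ybar, zbar, hxlim, hy, hz, hs.stationary, fun u v huv => ?_,
    hs.primal_optimal hconv hdiff hP, ?_, ?_, fun N hN => ?_⟩
  · have := hs.le_dualObj hP u v
    rw [huv, inner_zero_right, add_zero] at this
    rwa [hD]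
  · rw [hD]; exact EReal.coe_ne_top _
  · rw [hD]; exact EReal.coe_ne_bot _
  have hupper := hit.dualObj_ergodicAvg_le hL hconv hdiff hLip hq hs hx hN
  have hlower := hs.le_dualObj hP (PPG.ergodicAvg x N) (PPG.ergodicAvg y N)
  have hres := hit.norm_residual_le hL hconv hdiff hLip hq hs hx hN
  have hN0 : (0 : ℝ) < N := by exact_mod_cast hN
  have hE := PPG.energy_nonneg hL hq ybar zbar (y 0) (z 0)
  rw [PPG.seminormOf_sq (hq _), hD]
  simp only [PPG.energy, sub_zero] at hupper hres hE
  obtain ⟨d, hd⟩ : ∃ d : ℝ,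
      PPG.dualObj h P b (PPG.ergodicAvg x N) (PPG.ergodicAvg y N) = d :=
    ⟨_, (EReal.coe_toReal (ne_top_of_le_ne_top (EReal.coe_ne_top _) hupper)
      (ne_bot_of_le_ne_bot (EReal.coe_ne_bot _) hlower)).symm⟩
  rw [hd, EReal.coe_le_coe_iff] at hupper hlower
  rw [hd, ← EReal.coe_sub, EReal.coe_le_coe_iff, EReal.coe_le_coe_iff]
  refine ⟨?_, ?_, hres⟩
  · have h1 := abs_le.1
      (abs_real_inner_le_norm zbar (PPG.ergodicAvg x N + M.adjoint (PPG.ergodicAvg y N)))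
    have h2 := mul_le_mul_of_nonneg_left hres (norm_nonneg zbar)
    linarith [h1.1]
  -- The bound already holds with the `1 / (2N)` term alone; the remaining term is nonnegative.
  · have h3 := mul_nonneg (one_div_pos.2 hN0).le hE
    linarith
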